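/- Let $k\ge 1$ and let $G$ be a simple graph with vertex set $\{1,\dots,k\}$. For a $k$-tuple $u=(u_1,\dots,u_k)$ of positive integers and a positive integer $n$, let $Q_G^{(u)}(n)$ be the number of $k$-tuples $(a_1,\dots,a_k)$ of integers with $1\le a_i\le n$ for all $i$, such that $\gcd(a_i,a_j)=1$ for every edge $\{i,j\}$ of $G$ and $\gcd(a_i,u_i)=1$ for every $i$. Let $i_m(G)$ be the number of independent sets of $m$ vertices of $G$ (sets in which no two vertices are adjacent) and, for a set $S$ of vertices, let $i_{m,S}(G)$ be the number of those that contain at least one vertex of $S$. For a prime $p$ put $S(u,p)=\{i : p\mid u_i\}$. Let $\theta(u)=\max_{1\le i\le k}\theta(u_i)$, where $\theta(u_i)$ is the number of squarefree divisors of $u_i$. Then the infinite product over all primes $$A_G=\prod_p\left(\sum_{m=0}^{k} i_m(G)\left(1-\frac1p\right)^{k-m}\frac1{p^m}\right)$$ converges unconditionally, and, with $$f_G(u)=\prod_{p\mid u_1u_2\cdots u_k}\left(1-\frac{\sum_{m=0}^{k} i_{m,S(u,p)}(G)\,(p-1)^{k-m}}{\sum_{m=0}^{k} i_m(G)\,(p-1)^{k-m}}\right),$$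 where $p$ runs over primes, one has $$Q_G^{(u)}(n)=A_G\,f_G(u)\,n^k+O\!\left(\theta(u)\,n^{k-1}\log^{k-1}n\right)$$ uniformly for all integers $n\ge 2$ and all $u_1,\dots,u_k\ge 1$; that is, the implied constant depends only on $G$ (and $k$). -/

import Mathlib

noncomputable section

namespace GWise

open Classical in
/-- `Q_G^{(u)}(n)`: the number of tuples `a` with `1 ≤ a i ≤ n` such that `a i` and `a j` are coprime
for every edge `{i, j}` of `G`, and `a i` is coprime to `u i` for every `i`. -/
def Q {k : ℕ} (G : SimpleGraph (Fin k)) (u : Fin k → ℕ) (n : ℕ) : ℕ :=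
  ((Fintype.piFinset fun _ : Fin k => Finset.Icc 1 n).filter fun a =>
    (∀ i j, G.Adj i j → Nat.Coprime (a i) (a j)) ∧ ∀ i, Nat.Coprime (a i) (u i)).card

open Classical in
/-- `i_m(G)`: the number of independent sets of cardinality `m` in `G`. -/
def numIndep {k : ℕ} (G : SimpleGraph (Fin k)) (m : ℕ) : ℕ :=
  (Finset.univ.filter fun T : Finset (Fin k) => G.IsNIndepSet m T).card

open Classical in
/-- `i_{m,S}(G)`: the number of independent sets of cardinality `m` in `G` that contain at least one
vertex of `S`. -/
def numIndepMeeting {k : ℕ} (G : SimpleGraph (Fin k)) (S : Finset (Fin k)) (m : ℕ) : ℕ :=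
  (Finset.univ.filter fun T : Finset (Fin k) => G.IsNIndepSet m T ∧ ∃ v ∈ T, v ∈ S).card

/-- `S(u, d)`: the set of indices `i` such that `d` divides `u i`. -/
def divIndices {k : ℕ} (u : Fin k → ℕ) (d : ℕ) : Finset (Fin k) :=
  Finset.univ.filter fun i => d ∣ u i

/-- The factor of `A_G` at `p`. -/
def localFactor {k : ℕ} (G : SimpleGraph (Fin k)) (p : ℕ) : ℝ :=
  ∑ m ∈ Finset.range (k + 1), (numIndep G m : ℝ) * (1 - 1 / (p : ℝ)) ^ (k - m) * (1 / (p : ℝ) ^ m)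

/-- `A_G`, the product of the local factors over all primes. -/
def A {k : ℕ} (G : SimpleGraph (Fin k)) : ℝ :=
  ∏' p : Nat.Primes, localFactor G (p : ℕ)

/-- `f_G(u)`, a finite product over the primes dividing `u_1 ⋯ u_k`. -/
def f {k : ℕ} (G : SimpleGraph (Fin k)) (u : Fin k → ℕ) : ℝ :=
  ∏ p ∈ (∏ i, u i).primeFactors,
    (1 - (∑ m ∈ Finset.range (k + 1),
            (numIndepMeeting G (divIndices u p) m : ℝ) * ((p : ℝ) - 1) ^ (k - m)) /
         (∑ m ∈ Finset.range (k + 1), (numIndep G m : ℝ) * ((p : ℝ) - 1) ^ (k - m)))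

open Classical in
/-- The number of squarefree divisors of `v`. -/
def numSqfreeDivisors (v : ℕ) : ℕ :=
  (v.divisors.filter fun d => Squarefree d).card

/-- `θ(u)`: the maximum over `i` of the number of squarefree divisors of `u i`. -/
def theta {k : ℕ} (u : Fin k → ℕ) : ℕ :=
  Finset.univ.sup fun i => numSqfreeDivisors (u i)

end GWise

end

namespace GWise

open Finset

/-! The coprimality conditions say that, for every prime p, the set of indices i with p ∣ a_i is
independent in G and avoids S(u,p). Heuristically each index lies in this set independently with
probability 1/p, so the density should be the product over p of `avoidProb (1 / p) k G (S p)`. The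
local factor of A_G is this probability with nothing forbidden, and f_G(u) is the correction at the
primes dividing some u_i.

The error term comes from `exists_abs_sieveCount_sub_le`, by induction on k over a finite set P of
primes, with constants independent of P. Once a = a_1 is fixed, the remaining entries form the same
problem on the other vertices, with the neighbours of the first vertex newly forbidden at each p ∣
a. Its main term is a constant times a product over p ∣ a of weights 1 - x p, with x p = O(1/p)
unless p ∣ u_1. The sum over a is estimated by `abs_sieveSum_sub_le_log` (Rankin's trick), and the
errors from the induction hypothesis, inflated by 2 to the number of p ∈ P dividing a, average to
O(log n). Each vertex thus costs one factor n log n.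

Finally P grows to all primes: the count is constant once P contains the primes up to n, and the
product of local factors tends to A_G. -/

/-! ### One-variable sieve sums and Rankin's trick. -/

/-- The sum over `1 ≤ a ≤ m` of the product of `1 - x p` over the `p ∈ P` dividing `a`. -/
noncomputable def sieveSum (P : Finset ℕ) (x : ℕ → ℝ) (m : ℕ) : ℝ :=
  ∑ a ∈ Icc 1 m, ∏ p ∈ P, if p ∣ a then 1 - x p else 1

theorem sum_Icc_ite_dvd (g : ℕ → ℝ) {p : ℕ} (hp : 0 < p) (m : ℕ) :
    ∑ a ∈ Icc 1 m, (if p ∣ a then g a else 0) = ∑ b ∈ Icc 1 (m / p), g (p * b) := by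
  rw [← Finset.sum_filter]
  symm
  refine Finset.sum_bij (fun b _ => p * b) ?_ ?_ ?_ ?_
  · intro b hb
    simp only [mem_Icc, mem_filter, dvd_mul_right, and_true] at hb ⊢
    refine ⟨Nat.mul_pos hp hb.1, ?_⟩
    exact (Nat.mul_le_mul_left p hb.2).trans (Nat.mul_div_le m p)
  · intro a _ b _ h
    exact Nat.eq_of_mul_eq_mul_left hp h
  · intro a ha
    simp only [mem_Icc, mem_filter] at ha
    obtain ⟨b, rfl⟩ := ha.2
    refine ⟨b, ?_, rfl⟩
    simp only [mem_Icc]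
    refine ⟨?_, ?_⟩
    · exact Nat.pos_of_ne_zero (by rintro rfl; simp at ha)
    · rw [Nat.le_div_iff_mul_le hp, mul_comm]; exact ha.1.2
  · intros; rfl

theorem sieveSum_insert {P : Finset ℕ} {p : ℕ} (hP : ∀ q ∈ P, q.Prime) (hp : p.Prime)
    (hpP : p ∉ P) (x : ℕ → ℝ) (m : ℕ) :
    sieveSum (insert p P) x m = sieveSum P x m - x p * sieveSum P x (m / p) := by
  have h := sum_Icc_ite_dvd (fun a => ∏ q ∈ P, if q ∣ a then 1 - x q else 1) hp.pos m
  have h2 : ∀ b : ℕ, (∏ q ∈ P, if q ∣ p * b then 1 - x q else 1) =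
      ∏ q ∈ P, if q ∣ b then 1 - x q else 1 := by
    intro b
    refine Finset.prod_congr rfl fun q hq => ?_
    have : q ∣ p * b ↔ q ∣ b := by
      rw [(hP q hq).dvd_mul, Nat.prime_dvd_prime_iff_eq (hP q hq) hp]
      constructor
      · rintro (rfl | h)
        · exact absurd hq hpP
        · exact h
      · exact Or.inr
    simp only [this]
  simp only [h2] at h
  unfold sieveSum
  rw [← h, Finset.mul_sum, ← Finset.sum_sub_distrib]
  refine Finset.sum_congr rfl fun a _ => ?_
  rw [Finset.prod_insert hpP]
  split_ifs <;> ring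

/-- Primes are inserted one at a time through `sieveSum_insert`, and main term and bound obey
matching recursions t ↦ t / p. Real t is needed since t / p is rarely an integer. The free exponent
σ is Rankin's parameter; without primes the bound is |⌊t⌋ - t| ≤ t ^ σ. -/
theorem abs_sieveSum_sub_le {P : Finset ℕ} (hP : ∀ q ∈ P, q.Prime) {x : ℕ → ℝ}
    (hx : ∀ p, 0 ≤ x p) {σ : ℝ} (h0 : 0 ≤ σ) (h1 : σ ≤ 1) {t : ℝ} (ht : 0 ≤ t) :
    |sieveSum P x ⌊t⌋₊ - t * ∏ p ∈ P, (1 - x p / p)| ≤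
      t ^ σ * ∏ p ∈ P, (1 + x p * (p : ℝ) ^ (-σ)) := by
  induction P using Finset.induction_on generalizing t with
  | empty =>
    simp only [sieveSum, prod_empty, mul_one, sum_const, Nat.card_Icc, add_tsub_cancel_right,
      nsmul_eq_mul]
    have hfl := Nat.floor_le ht
    rw [abs_sub_comm, abs_of_nonneg (by linarith)]
    rcases lt_or_ge t 1 with h | h
    · have : t ^ (1 : ℝ) ≤ t ^ σ := by
        rcases ht.eq_or_lt with rfl | ht'
        · rw [Real.zero_rpow one_ne_zero]; exact Real.rpow_nonneg le_rfl _
        · exact Real.rpow_le_rpow_of_exponent_ge ht' h.le h1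
      rw [Real.rpow_one] at this
      have := Nat.cast_nonneg (α := ℝ) ⌊t⌋₊
      linarith
    · have := Nat.lt_floor_add_one t
      have := Real.one_le_rpow h h0
      linarith
  | insert p P hpP ih =>
    have hp : p.Prime := hP p (mem_insert_self _ _)
    have hP' : ∀ q ∈ P, q.Prime := fun q hq => hP q (mem_insert_of_mem hq)
    have hp0 : (0 : ℝ) < p := by exact_mod_cast hp.pos
    have e1 := ih hP' ht
    have e2 := ih hP' (t := t / p) (by positivity)
    rw [Nat.floor_div_natCast] at e2
    rw [sieveSum_insert hP' hp hpP, Finset.prod_insert hpP, Finset.prod_insert hpP]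
    set B := ∏ p ∈ P, (1 - x p / p)
    set R := ∏ p ∈ P, (1 + x p * (p : ℝ) ^ (-σ))
    have hxp := hx p
    have e3 : t ^ σ * ((1 + x p * (p : ℝ) ^ (-σ)) * R) = t ^ σ * R + x p * ((t / p) ^ σ * R) := by
      rw [Real.div_rpow ht hp0.le, Real.rpow_neg hp0.le]; ring
    have e4 : sieveSum P x ⌊t⌋₊ - x p * sieveSum P x (⌊t⌋₊ / p) - t * ((1 - x p / p) * B) =
        (sieveSum P x ⌊t⌋₊ - t * B) - x p * (sieveSum P x (⌊t⌋₊ / p) - t / p * B) := by ring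
    rw [e3, e4]
    refine (abs_sub _ _).trans (add_le_add e1 ?_)
    rw [abs_mul, abs_of_nonneg hxp]
    exact mul_le_mul_of_nonneg_left e2 hxp

theorem sieveSum_neg_one_le {P : Finset ℕ} (hP : ∀ q ∈ P, q.Prime) {σ : ℝ} (h0 : 0 ≤ σ)
    {t : ℝ} (ht : 0 ≤ t) :
    sieveSum P (fun _ => -1) ⌊t⌋₊ ≤ t ^ (1 + σ) * ∏ p ∈ P, (1 + (p : ℝ) ^ (-(1 + σ))) := by
  induction P using Finset.induction_on generalizing t with
  | empty =>
    simp only [sieveSum, prod_empty, mul_one, sum_const, Nat.card_Icc, add_tsub_cancel_right,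
      nsmul_eq_mul]
    rcases lt_or_ge t 1 with h | h
    · rw [Nat.floor_eq_zero.2 h]; simpa using Real.rpow_nonneg ht _
    · refine (Nat.floor_le ht).trans ?_
      simpa using Real.rpow_le_rpow_of_exponent_le h (by linarith : (1 : ℝ) ≤ 1 + σ)
  | insert p P hpP ih =>
    have hp : p.Prime := hP p (mem_insert_self _ _)
    have hP' : ∀ q ∈ P, q.Prime := fun q hq => hP q (mem_insert_of_mem hq)
    have hp0 : (0 : ℝ) < p := by exact_mod_cast hp.pos
    have e1 := ih hP' ht
    have e2 := ih hP' (t := t / p) (by positivity)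
    rw [Nat.floor_div_natCast] at e2
    rw [sieveSum_insert hP' hp hpP, Finset.prod_insert hpP]
    set R := ∏ p ∈ P, (1 + (p : ℝ) ^ (-(1 + σ)))
    have e3 : t ^ (1 + σ) * ((1 + (p : ℝ) ^ (-(1 + σ))) * R) =
        t ^ (1 + σ) * R + (t / p) ^ (1 + σ) * R := by
      rw [Real.div_rpow ht hp0.le, Real.rpow_neg hp0.le]; ring
    rw [e3]
    linarith

/-- The right side is the integral of x ^ (-(1 + σ)) over [d, d + 1], whose integrand is least at d
+ 1. It telescopes when summed over d. -/
theorem rpow_neg_le_sub {σ : ℝ} (h0 : 0 < σ) {d : ℝ} (hd : 1 ≤ d) :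
    (d + 1) ^ (-(1 + σ)) ≤ (d ^ (-σ) - (d + 1) ^ (-σ)) / σ := by
  have hd0 : 0 < d := by linarith
  have hd1 : 0 < d + 1 := by linarith
  have hB : 1 + σ / (d + 1) ≤ ((d + 1) / d) ^ σ := by
    rw [Real.rpow_def_of_pos (by positivity)]
    have h1 : 1 / (d + 1) ≤ Real.log ((d + 1) / d) := by
      have := Real.one_sub_inv_le_log_of_pos (x := (d + 1) / d) (by positivity)
      have e : 1 - ((d + 1) / d)⁻¹ = 1 / (d + 1) := by field_simp; ring
      linarith
    have h2 := Real.add_one_le_exp (Real.log ((d + 1) / d) * σ)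
    have h3 : σ / (d + 1) ≤ Real.log ((d + 1) / d) * σ := by
      have := mul_le_mul_of_nonneg_right h1 h0.le
      calc _ = 1 / (d + 1) * σ := by ring
        _ ≤ _ := this
    linarith
  rw [le_div_iff₀ h0]
  have e1 : d ^ (-σ) = (d + 1) ^ (-σ) * ((d + 1) / d) ^ σ := by
    rw [Real.div_rpow hd1.le hd0.le, Real.rpow_neg hd0.le, Real.rpow_neg hd1.le]
    have := Real.rpow_pos_of_pos hd1 σ
    field_simp
  have e2 : (d + 1) ^ (-(1 + σ)) = (d + 1) ^ (-σ) / (d + 1) := by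
    rw [show -(1 + σ) = -σ - 1 by ring, Real.rpow_sub_one hd1.ne']
  have hpos := Real.rpow_pos_of_pos hd1 (-σ)
  rw [e1, e2]
  have := mul_le_mul_of_nonneg_left hB hpos.le
  calc _ = (d + 1) ^ (-σ) * (1 + σ / (d + 1)) - (d + 1) ^ (-σ) := by ring
    _ ≤ _ := by linarith

theorem sum_Icc_rpow_neg_le {σ : ℝ} (h0 : 0 < σ) (N : ℕ) :
    ∑ d ∈ Icc 1 N, (d : ℝ) ^ (-(1 + σ)) ≤ 1 + 1 / σ := by
  have key : ∀ N : ℕ, ∑ d ∈ Icc 1 (N + 1), (d : ℝ) ^ (-(1 + σ)) ≤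
      1 + (1 - ((N + 1 : ℕ) : ℝ) ^ (-σ)) / σ := by
    intro N
    induction N with
    | zero => simp
    | succ N ih =>
      rw [Finset.sum_Icc_succ_top (by omega)]
      have h := rpow_neg_le_sub h0 (d := ((N + 1 : ℕ) : ℝ))
        (by push_cast; linarith [Nat.cast_nonneg (α := ℝ) N])
      have e : ((N + 1 : ℕ) : ℝ) + 1 = ((N + 1 + 1 : ℕ) : ℝ) := by push_cast; ring
      rw [e] at h
      calc _ ≤ _ := add_le_add ih h
        _ = _ := by ring
  rcases N with _ | N
  · simp; positivity
  · refine (key N).trans ?_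
    gcongr
    have := Real.rpow_nonneg (Nat.cast_nonneg (α := ℝ) (N + 1)) (-σ)
    linarith

/-- Expanding the product gives a sum over distinct squarefree integers, hence part of the series
for ζ(1 + σ). -/
theorem prod_one_add_rpow_neg_le {P : Finset ℕ} (hP : ∀ q ∈ P, q.Prime) {σ : ℝ} (h0 : 0 < σ) :
    ∏ p ∈ P, (1 + (p : ℝ) ^ (-(1 + σ))) ≤ 1 + 1 / σ := by
  rw [Finset.prod_one_add]
  have hne : ∀ D ∈ P.powerset, ∀ q ∈ D, q.Prime := fun D hD q hq => hP q (mem_powerset.1 hD hq)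
  have hinj : Set.InjOn (fun D : Finset ℕ => ∏ p ∈ D, p) (P.powerset : Finset (Finset ℕ)) := by
    intro D hD E hE h
    have h' := congrArg Nat.primeFactors h
    simpa [Nat.primeFactors_prod (hne D hD), Nat.primeFactors_prod (hne E hE)] using h'
  have h1 : ∑ D ∈ P.powerset, ∏ p ∈ D, (p : ℝ) ^ (-(1 + σ)) =
      ∑ d ∈ P.powerset.image (fun D => ∏ p ∈ D, p), (d : ℝ) ^ (-(1 + σ)) := by
    rw [Finset.sum_image hinj]
    refine Finset.sum_congr rfl fun D _ => ?_
    rw [Nat.cast_prod, Real.finsetProd_rpow _ _ fun _ _ => Nat.cast_nonneg _]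
  rw [h1]
  refine le_trans ?_ (sum_Icc_rpow_neg_le h0 (∏ p ∈ P, p))
  refine Finset.sum_le_sum_of_subset_of_nonneg ?_ fun _ _ _ => Real.rpow_nonneg (Nat.cast_nonneg _) _
  intro d hd
  obtain ⟨D, hD, rfl⟩ := Finset.mem_image.1 hd
  rw [mem_Icc]
  refine ⟨Finset.prod_pos fun q hq => (hne D hD q hq).pos, ?_⟩
  exact Finset.prod_le_prod_of_subset_of_one_le' (mem_powerset.1 hD) fun q hq _ => (hP q hq).one_lt.le

theorem rpow_inv_one_add_log_le {n : ℕ} (hn : 1 ≤ n) :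
    (n : ℝ) ^ (1 / (1 + Real.log n)) ≤ Real.exp 1 := by
  have hn0 : (0 : ℝ) < n := by exact_mod_cast hn
  have hl : 0 ≤ Real.log n := Real.log_natCast_nonneg n
  rw [Real.rpow_def_of_pos hn0]
  apply Real.exp_le_exp.2
  rw [mul_one_div, div_le_one (by linarith)]
  linarith

theorem prod_one_add_rpow_le_log {P : Finset ℕ} (hP : ∀ q ∈ P, q.Prime) (n : ℕ) :
    ∏ p ∈ P, (1 + (p : ℝ) ^ (-(1 + 1 / (1 + Real.log n)))) ≤ 2 * (1 + Real.log n) := by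
  have hl : 0 ≤ Real.log n := Real.log_natCast_nonneg n
  refine (prod_one_add_rpow_neg_le hP (by positivity)).trans ?_
  rw [one_div_one_div]; linarith

/-- The weight x = -1 turns the sieve sum into a sum of powers of 2. Taking σ = 1 / (1 + log n)
keeps n ^ σ ≤ e while the Euler product stays O(1 + log n); using 1 + log n rather than log n admits
n = 1. -/
theorem sieveSum_two_pow_le {P : Finset ℕ} (hP : ∀ q ∈ P, q.Prime) {n : ℕ} (hn : 1 ≤ n) :
    ∑ a ∈ Icc 1 n, (2 : ℝ) ^ #{p ∈ P | p ∣ a} ≤ 2 * Real.exp 1 * (n * (1 + Real.log n)) := by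
  have hl : 0 ≤ Real.log n := Real.log_natCast_nonneg n
  have hn0 : (0 : ℝ) < n := by exact_mod_cast hn
  have h := sieveSum_neg_one_le hP (σ := 1 / (1 + Real.log n)) (by positivity) hn0.le
  rw [Nat.floor_natCast] at h
  have e : sieveSum P (fun _ => -1) n = ∑ a ∈ Icc 1 n, (2 : ℝ) ^ #{p ∈ P | p ∣ a} := by
    refine Finset.sum_congr rfl fun a _ => ?_
    rw [← Finset.prod_filter, Finset.prod_const]
    norm_num
  rw [← e]
  refine h.trans ?_
  rw [Real.rpow_add hn0, Real.rpow_one]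
  calc (n : ℝ) * (n : ℝ) ^ (1 / (1 + Real.log n)) * _
      ≤ n * Real.exp 1 * (2 * (1 + Real.log n)) := by
        apply mul_le_mul _ (prod_one_add_rpow_le_log hP n)
          (Finset.prod_nonneg fun _ _ => by positivity) (by positivity)
        exact mul_le_mul_of_nonneg_left (rpow_inv_one_add_log_le hn) hn0.le
    _ = _ := by ring

/-- The one-variable sieve estimate: weights `x p ≤ c / p` outside a set `U`, and `x p ≤ 1` on it. -/
theorem abs_sieveSum_sub_le_log {P : Finset ℕ} (hP : ∀ q ∈ P, q.Prime) {x : ℕ → ℝ}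
    (hx : ∀ p, 0 ≤ x p) (U : ℕ → Prop) [DecidablePred U] (c : ℕ)
    (hU : ∀ p ∈ P, U p → x p ≤ 1) (hc : ∀ p ∈ P, ¬ U p → x p ≤ c / p) {n : ℕ} (hn : 1 ≤ n) :
    |sieveSum P x n - n * ∏ p ∈ P, (1 - x p / p)| ≤
      Real.exp 1 * 2 ^ c * ((2 : ℝ) ^ #{p ∈ P | U p} * (1 + Real.log n) ^ c) := by
  have hl : 0 ≤ Real.log n := Real.log_natCast_nonneg n
  set σ := 1 / (1 + Real.log n) with hσ
  have hσ0 : 0 ≤ σ := by positivity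
  have hσ1 : σ ≤ 1 := by rw [hσ, div_le_one (by linarith)]; linarith
  have h := abs_sieveSum_sub_le hP hx hσ0 hσ1 (Nat.cast_nonneg (α := ℝ) n)
  rw [Nat.floor_natCast] at h
  refine h.trans ?_
  -- On U the factor is at most 2; off U, Bernoulli's inequality bounds 1 + c p^(-1-σ) by a c-th
  -- power.
  have hprod : ∏ p ∈ P, (1 + x p * (p : ℝ) ^ (-σ)) ≤
      ∏ p ∈ P, ((if U p then 2 else 1) * (1 + (p : ℝ) ^ (-(1 + σ))) ^ c) := by
    refine Finset.prod_le_prod (fun p _ => ?_) fun p hp => ?_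
    · have := hx p; positivity
    · have hp1 : (1 : ℝ) ≤ p := by exact_mod_cast (hP p hp).one_lt.le
      have hp0 : (0 : ℝ) < p := by linarith
      have hy : 0 ≤ (p : ℝ) ^ (-(1 + σ)) := by positivity
      split_ifs with hUp
      · have h1 : (p : ℝ) ^ (-σ) ≤ 1 := Real.rpow_le_one_of_one_le_of_nonpos hp1 (by linarith)
        have h2 : x p * (p : ℝ) ^ (-σ) ≤ 1 := mul_le_one₀ (hU p hp hUp) (by positivity) h1
        have h3 : 1 ≤ (1 + (p : ℝ) ^ (-(1 + σ))) ^ c := one_le_pow₀ (by linarith)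
        linarith
      · have h1 := one_add_mul_le_pow (a := (p : ℝ) ^ (-(1 + σ))) (by linarith) c
        have h2 : x p * (p : ℝ) ^ (-σ) ≤ c / p * (p : ℝ) ^ (-σ) :=
          mul_le_mul_of_nonneg_right (hc p hp hUp) (by positivity)
        have h3 : (c : ℝ) / p * (p : ℝ) ^ (-σ) = c * (p : ℝ) ^ (-(1 + σ)) := by
          rw [show -(1 + σ) = -σ - 1 by ring, Real.rpow_sub_one hp0.ne']; ring
        linarith
  rw [Finset.prod_mul_distrib, ← Finset.prod_filter, Finset.prod_const, Finset.prod_pow] at hprod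
  have hlog := prod_one_add_rpow_le_log hP n
  have hnn : 0 ≤ ∏ p ∈ P, (1 + (p : ℝ) ^ (-(1 + σ))) := Finset.prod_nonneg fun _ _ => by positivity
  calc (n : ℝ) ^ σ * ∏ p ∈ P, (1 + x p * (p : ℝ) ^ (-σ))
      ≤ Real.exp 1 * (2 ^ #{p ∈ P | U p} * (2 * (1 + Real.log n)) ^ c) := by
        apply mul_le_mul (rpow_inv_one_add_log_le hn) (hprod.trans _)
          (Finset.prod_nonneg fun p _ => by have := hx p; positivity) (by positivity)
        gcongr
    _ = _ := by rw [mul_pow]; ring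

/-! ### The probability that a random vertex set is independent and avoids a given set. -/

open Classical in
/-- The probability that a random set of vertices, containing each vertex independently with
probability `q`, is independent in `G` and contains no `i` with `S i`. -/
noncomputable def avoidProb (q : ℝ) : (k : ℕ) → SimpleGraph (Fin k) → (Fin k → Prop) → ℝ
  | 0, _, _ => 1
  | k + 1, G, S =>
    (1 - q) * avoidProb q k (G.comap Fin.succ) (fun i => S i.succ) +
      if S 0 then 0 else
        q * avoidProb q k (G.comap Fin.succ) (fun i => S i.succ ∨ G.Adj 0 i.succ)

theorem avoidProb_nonneg {q : ℝ} (h0 : 0 ≤ q) (h1 : q ≤ 1) {k : ℕ} (G : SimpleGraph (Fin k))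
    (S : Fin k → Prop) : 0 ≤ avoidProb q k G S := by
  induction k with
  | zero => simp [avoidProb]
  | succ k ih =>
    rw [avoidProb]
    refine add_nonneg (mul_nonneg (by linarith) (ih _ _)) ?_
    split_ifs
    · exact le_rfl
    · exact mul_nonneg h0 (ih _ _)

theorem avoidProb_pos {q : ℝ} (h0 : 0 ≤ q) (h1 : q < 1) {k : ℕ} (G : SimpleGraph (Fin k))
    (S : Fin k → Prop) : 0 < avoidProb q k G S := by
  induction k with
  | zero => simp [avoidProb]
  | succ k ih =>
    rw [avoidProb]
    refine add_pos_of_pos_of_nonneg (mul_pos (by linarith) (ih _ _)) ?_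
    split_ifs
    · exact le_rfl
    · exact mul_nonneg h0 (ih _ _).le

theorem avoidProb_anti {q : ℝ} (h0 : 0 ≤ q) (h1 : q ≤ 1) {k : ℕ} (G : SimpleGraph (Fin k))
    {S T : Fin k → Prop} (h : ∀ i, S i → T i) : avoidProb q k G T ≤ avoidProb q k G S := by
  induction k with
  | zero => simp [avoidProb]
  | succ k ih =>
    rw [avoidProb, avoidProb]
    refine add_le_add (mul_le_mul_of_nonneg_left (ih _ fun i => h _) (by linarith)) ?_
    split_ifs with hT hS hS
    · exact le_rfl
    · exact mul_nonneg h0 (avoidProb_nonneg h0 h1 _ _)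
    · exact absurd (h 0 hS) hT
    · exact mul_le_mul_of_nonneg_left (ih _ fun i => Or.imp_left (h _)) h0

theorem avoidProb_le_one {q : ℝ} (h0 : 0 ≤ q) (h1 : q ≤ 1) {k : ℕ} (G : SimpleGraph (Fin k))
    (S : Fin k → Prop) : avoidProb q k G S ≤ 1 := by
  induction k with
  | zero => simp [avoidProb]
  | succ k ih =>
    rw [avoidProb]
    have a := mul_le_mul_of_nonneg_left (ih (G.comap Fin.succ) fun i => S i.succ)
      (by linarith : 0 ≤ 1 - q)
    have b := mul_le_mul_of_nonneg_left
      (ih (G.comap Fin.succ) fun i => S i.succ ∨ G.Adj 0 i.succ) h0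
    split_ifs <;> linarith

/-- Forbidding one more vertex costs at most a proportion `q`. -/
theorem avoidProb_insert_ge {q : ℝ} (h0 : 0 ≤ q) (h1 : q ≤ 1) {k : ℕ} (G : SimpleGraph (Fin k))
    (S : Fin k → Prop) (v : Fin k) :
    (1 - q) * avoidProb q k G S ≤ avoidProb q k G (fun i => S i ∨ i = v) := by
  induction k with
  | zero => exact v.elim0
  | succ k ih =>
    rw [avoidProb, avoidProb]
    have hq : 0 ≤ 1 - q := by linarith
    cases v using Fin.cases with
    | zero =>
      have e : (fun i : Fin k => S i.succ ∨ i.succ = 0) = fun i => S i.succ := by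
        funext i; simp [Fin.succ_ne_zero]
      simp only [e, or_true, if_true, add_zero]
      apply mul_le_mul_of_nonneg_left _ hq
      -- If vertex 0 becomes forbidden, only the branch omitting it survives; the old probability is
      -- at most that of the smaller graph, since q X' ≤ q X.
      have a := avoidProb_nonneg h0 h1 (G.comap Fin.succ) fun i => S i.succ
      have b := mul_le_mul_of_nonneg_left (avoidProb_anti h0 h1 (G.comap Fin.succ)
        (S := fun i => S i.succ) (T := fun i => S i.succ ∨ G.Adj 0 i.succ) fun i => Or.inl) h0
      split_ifs
      · nlinarith
      · linarith
    | succ v =>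
      have a := mul_le_mul_of_nonneg_left (ih (G.comap Fin.succ) (fun i => S i.succ) v) hq
      have b := mul_le_mul_of_nonneg_left
        (ih (G.comap Fin.succ) (fun i => S i.succ ∨ G.Adj 0 i.succ) v) h0
      have e : (fun i : Fin k => (S i.succ ∨ G.Adj 0 i.succ) ∨ i = v) =
          fun i => (S i.succ ∨ i = v) ∨ G.Adj 0 i.succ := by
        funext i; exact propext or_right_comm
      rw [e] at b
      simp only [Fin.succ_inj]
      by_cases hS : S 0
      · rw [if_pos hS, if_pos (Or.inl hS)]
        linarith
      · rw [if_neg hS, if_neg (by simp [hS, (Fin.succ_ne_zero v).symm])]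
        linarith

theorem avoidProb_or_ge {q : ℝ} (h0 : 0 ≤ q) (h1 : q ≤ 1) {k : ℕ} (G : SimpleGraph (Fin k))
    (S N : Fin k → Prop) :
    (1 - k * q) * avoidProb q k G S ≤ avoidProb q k G (fun i => S i ∨ N i) := by
  have key : ∀ F : Finset (Fin k),
      (1 - #F * q) * avoidProb q k G S ≤ avoidProb q k G (fun i => S i ∨ i ∈ F) := by
    intro F
    induction F using Finset.induction_on with
    | empty => simp
    | insert v F hv ih =>
      have h := avoidProb_insert_ge h0 h1 G (fun i => S i ∨ i ∈ F) v
      have e : (fun i => (S i ∨ i ∈ F) ∨ i = v) = fun i => S i ∨ i ∈ insert v F := by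
        funext i; simp only [mem_insert]; exact propext (by tauto)
      rw [e] at h
      refine le_trans ?_ h
      have hle := avoidProb_anti h0 h1 G (S := S) (T := fun i => S i ∨ i ∈ F) fun i => Or.inl
      have := mul_le_mul_of_nonneg_left hle h0
      rw [card_insert_of_notMem hv]
      push_cast
      linarith
  refine le_trans ?_ ((key univ).trans (avoidProb_anti h0 h1 G ?_))
  · simp
  · intro i; simp only [mem_univ, or_true, implies_true]

/-- A failure requires both ends of some edge, so it has order q². In the recursion, adding a vertex
to k others raises the defect by at most k q². This gives absolute convergence of A_G. -/
theorem one_sub_avoidProb_le {q : ℝ} (h0 : 0 ≤ q) (h1 : q ≤ 1) {k : ℕ} (G : SimpleGraph (Fin k)) :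
    1 - avoidProb q k G (fun _ => False) ≤ k ^ 2 * q ^ 2 := by
  induction k with
  | zero => simp [avoidProb]
  | succ k ih =>
    have a := avoidProb_or_ge h0 h1 (G.comap Fin.succ) (fun _ => False) fun i => G.Adj 0 i.succ
    have b := ih (G.comap Fin.succ)
    have c := avoidProb_le_one h0 h1 (G.comap Fin.succ) fun _ => False
    rw [avoidProb, if_neg not_false]
    set X := avoidProb q k (G.comap Fin.succ) fun _ => False
    have d := mul_le_mul_of_nonneg_left a h0
    have e : (k : ℝ) * q ^ 2 * X ≤ k * q ^ 2 := mul_le_of_le_one_right (by positivity) c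
    push_cast
    nlinarith [mul_nonneg (Nat.cast_nonneg (α := ℝ) k) (sq_nonneg q)]

-- Subsets of `Fin (k + 1)` are split by whether they contain 0; those that do must avoid the
-- neighbours of 0, as in the recursion.
open Classical in
theorem avoidProb_eq_sum (q : ℝ) {k : ℕ} (G : SimpleGraph (Fin k)) (S : Fin k → Prop) :
    avoidProb q k G S = ∑ T : Finset (Fin k),
      if G.IsIndepSet T ∧ ∀ i ∈ T, ¬ S i then q ^ #T * (1 - q) ^ (k - #T) else 0 := by
  induction k with
  | zero =>
    rw [avoidProb, Fintype.sum_eq_single ∅]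
    · simp
    · intro T hT; exact absurd (Subsingleton.elim T ∅) hT
  | succ k ih =>
    have hu : (univ : Finset (Finset (Fin (k + 1)))) =
        (insert 0 (univ.map (Fin.succEmb k))).powerset := by
      ext T
      simp only [mem_univ, mem_powerset, true_iff]
      intro i _
      cases i using Fin.cases <;> simp
    rw [avoidProb, ih, ih, hu, Finset.sum_powerset_insert (by simp [Fin.succ_ne_zero])]
    have hp : (univ.map (Fin.succEmb k)).powerset =
        (univ : Finset (Finset (Fin k))).map (mapEmbedding (Fin.succEmb k)).toEmbedding := by
      ext T
      simp only [mem_powerset, mem_map, mem_univ, true_and]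
      constructor
      · intro h
        obtain ⟨u, -, rfl⟩ := Finset.subset_map_iff.1 h
        exact ⟨u, rfl⟩
      · rintro ⟨u, rfl⟩
        exact Finset.map_subset_map.2 (subset_univ u)
    rw [hp, sum_map, sum_map, Finset.mul_sum]
    congr 1
    · refine Finset.sum_congr rfl fun T _ => ?_
      have hc : #T ≤ k := by simpa using card_le_univ T
      simp only [RelEmbedding.coe_toEmbedding, mapEmbedding_apply, card_map]
      have e : (G.IsIndepSet (T.map (Fin.succEmb k)) ∧ ∀ i ∈ T.map (Fin.succEmb k), ¬ S i) ↔
          ((G.comap Fin.succ).IsIndepSet T ∧ ∀ i ∈ T, ¬ S i.succ) := by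
        simp [SimpleGraph.isIndepSet_iff, Set.Pairwise]
      simp only [e]
      split_ifs
      · rw [show k + 1 - #T = (k - #T) + 1 by omega]; ring
      · simp
    · have e : ∀ T : Finset (Fin k),
          (G.IsIndepSet (insert 0 (T.map (Fin.succEmb k)) : Finset (Fin (k + 1))) ∧
            ∀ i ∈ insert 0 (T.map (Fin.succEmb k)), ¬ S i) ↔
          (¬ S 0 ∧ (G.comap Fin.succ).IsIndepSet T ∧ ∀ i ∈ T, ¬ (S i.succ ∨ G.Adj 0 i.succ)) := by
        intro T
        have : Std.Symm fun a b => ¬ G.Adj a b := ⟨fun a b h => by rwa [G.adj_comm]⟩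
        simp only [SimpleGraph.isIndepSet_iff, coe_insert, coe_map, Fin.coe_succEmb,
          Set.pairwise_insert_of_symm, mem_insert, mem_map, Set.mem_image, forall_eq_or_imp,
          forall_exists_index, and_imp, mem_coe, forall_apply_eq_imp_iff₂, SimpleGraph.comap_adj]
        have : (Fin.succ '' (T : Set (Fin k))).Pairwise (fun a b => ¬ G.Adj a b) ↔
            (T : Set (Fin k)).Pairwise fun a b => ¬ G.Adj a.succ b.succ := by
          simp [Set.Pairwise]
        rw [this]
        have h0 : ∀ i : Fin k, (0 : Fin (k + 1)) ≠ i.succ := fun i => (Fin.succ_ne_zero i).symm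
        constructor
        · rintro ⟨⟨h1, h2⟩, h3, h4⟩
          exact ⟨h3, h1, fun i hi h => h.elim (h4 i hi) (h2 i hi (h0 i))⟩
        · rintro ⟨h3, h1, h2⟩
          exact ⟨⟨h1, fun i hi _ h => h2 i hi (Or.inr h)⟩, h3, fun i hi h => h2 i hi (Or.inl h)⟩
      simp only [RelEmbedding.coe_toEmbedding, mapEmbedding_apply, e]
      split_ifs with hS
      · simp [hS]
      · rw [Finset.mul_sum]
        refine Finset.sum_congr rfl fun T _ => ?_
        rw [card_insert_of_notMem (by simp [Fin.succ_ne_zero]), card_map]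
        simp only [hS, not_false_eq_true, true_and, Nat.add_sub_add_right]
        split_ifs
        · ring
        · simp

/-! ### Counting tuples by induction on the number of vertices. -/

open Classical in
/-- The number of `k`-tuples with entries in `[1, n]` in which, for every `p ∈ P`, the set of
entries divisible by `p` is independent in `G` and contains no index `i` with `S p i`. -/
noncomputable def sieveCount (n : ℕ) (P : Finset ℕ) :
    (k : ℕ) → SimpleGraph (Fin k) → (ℕ → Fin k → Prop) → ℕ
  | 0, _, _ => 1
  | k + 1, G, S => ∑ a ∈ Icc 1 n, if ∀ p ∈ P, p ∣ a → ¬ S p 0 then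
      sieveCount n P k (G.comap Fin.succ) (fun p i => S p i.succ ∨ (p ∣ a ∧ G.Adj 0 i.succ)) else 0

open Classical in
theorem sieveCount_eq_card (n : ℕ) (P : Finset ℕ) {k : ℕ} (G : SimpleGraph (Fin k))
    (S : ℕ → Fin k → Prop) :
    sieveCount n P k G S = #{a ∈ Fintype.piFinset fun _ : Fin k => Icc 1 n |
      (∀ i j, G.Adj i j → ∀ p ∈ P, ¬ (p ∣ a i ∧ p ∣ a j)) ∧ ∀ i, ∀ p ∈ P, p ∣ a i → ¬ S p i} := by
  induction k with
  | zero =>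
    rw [sieveCount, filter_true_of_mem]
    · simp
    · intro a _; exact ⟨fun i => i.elim0, fun i => i.elim0⟩
  | succ k ih =>
    rw [sieveCount]
    rw [Finset.card_eq_sum_card_fiberwise (f := fun a : Fin (k + 1) → ℕ => a 0) (t := Icc 1 n)]
    · refine Finset.sum_congr rfl fun x hx => ?_
      split_ifs with h
      · rw [ih]
        refine Finset.card_bij (fun a _ => Fin.cons x a) ?_ ?_ ?_
        · intro a ha
          simp only [mem_filter, Fintype.mem_piFinset, SimpleGraph.comap_adj] at ha ⊢
          obtain ⟨h1, h2, h3⟩ := ha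
          refine ⟨⟨?_, ?_, ?_⟩, rfl⟩
          · intro i; cases i using Fin.cases <;> simp_all
          · intro i j hij p hp
            cases i using Fin.cases with
            | zero =>
              cases j using Fin.cases with
              | zero => exact absurd hij (G.loopless.irrefl _)
              | succ j => exact fun hh => h3 j p hp hh.2 (Or.inr ⟨hh.1, hij⟩)
            | succ i =>
              cases j using Fin.cases with
              | zero => exact fun hh => h3 i p hp hh.1 (Or.inr ⟨hh.2, hij.symm⟩)
              | succ j => exact h2 i j hij p hp
          · intro i p hp
            cases i using Fin.cases with
            | zero => exact h p hp
            | succ i => exact fun hh hS => h3 i p hp hh (Or.inl hS)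
        · intro a _ b _ hab
          exact (Fin.cons_injective2 hab).2
        · intro b hb
          simp only [mem_filter, Fintype.mem_piFinset] at hb
          obtain ⟨⟨h1, h2, h3⟩, rfl⟩ := hb
          refine ⟨Fin.tail b, ?_, Fin.cons_self_tail b⟩
          simp only [mem_filter, Fintype.mem_piFinset, SimpleGraph.comap_adj, Fin.tail]
          refine ⟨fun i => h1 _, fun i j hij => h2 _ _ hij, fun i p hp hd hS => ?_⟩
          rcases hS with hS | hS
          · exact h3 _ p hp hd hS
          · exact h2 _ _ hS.2 p hp ⟨hS.1, hd⟩
      · symm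
        rw [card_eq_zero, filter_eq_empty_iff]
        rintro a ha rfl
        exact h ((mem_filter.1 ha).2.2 0)
    · intro a ha
      exact Fintype.mem_piFinset.1 (mem_filter.1 ha).1 0

-- The clause `k = 0 → C = 0` repairs truncated subtraction: at k = 0 the exponent k - 1 is 0, so
-- summing over a nonzero error would give n (1 + log n) instead of the required bound. The constant
-- depends only on k, and P enters only through θ.
open Classical in
theorem exists_abs_sieveCount_sub_le (k : ℕ) : ∃ C : ℝ, 0 ≤ C ∧ (k = 0 → C = 0) ∧
    ∀ (n : ℕ) (P : Finset ℕ) (G : SimpleGraph (Fin k)) (S : ℕ → Fin k → Prop) (θ : ℝ), 1 ≤ n →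
      (∀ p ∈ P, p.Prime) → (∀ i, (2 : ℝ) ^ #{p ∈ P | S p i} ≤ θ) →
      |(sieveCount n P k G S : ℝ) - n ^ k * ∏ p ∈ P, avoidProb (1 / p) k G (S p)| ≤
        C * (θ * n ^ (k - 1) * (1 + Real.log n) ^ (k - 1)) := by
  induction k with
  | zero =>
    refine ⟨0, le_rfl, fun _ => rfl, ?_⟩
    intros
    simp [sieveCount, avoidProb]
  | succ k ih =>
    obtain ⟨C, hC0, hCk, hC⟩ := ih
    refine ⟨C * (2 * Real.exp 1) + Real.exp 1 * 2 ^ k, by positivity, by simp, ?_⟩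
    intro n P G S θ hn hP hθ
    have hL : 0 ≤ Real.log n := Real.log_natCast_nonneg n
    have hθ0 : 0 ≤ θ := le_trans (by positivity) (hθ 0)
    have hq0 : ∀ p : ℕ, 0 ≤ 1 / (p : ℝ) := fun p => by positivity
    have hq1 : ∀ p : ℕ, 1 / (p : ℝ) ≤ 1 := fun p => by
      simpa using Nat.cast_inv_le_one (α := ℝ) p
    set G' := G.comap Fin.succ with hG'
    set V : ℕ → ℝ := fun p => avoidProb (1 / p) k G' fun i => S p i.succ with hV
    set V' : ℕ → ℝ := fun p => avoidProb (1 / p) k G' fun i => S p i.succ ∨ G.Adj 0 i.succ with hV'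
    have hVpos : ∀ p ∈ P, 0 < V p := fun p hp => by
      refine avoidProb_pos (hq0 p) ?_ _ _
      have : (1 : ℝ) < p := by exact_mod_cast (hP p hp).one_lt
      rw [div_lt_one (by linarith)]; exact this
    have hVnn : ∀ p, 0 ≤ V p := fun p => avoidProb_nonneg (hq0 p) (hq1 p) _ _
    have hV'nn : ∀ p, 0 ≤ V' p := fun p => avoidProb_nonneg (hq0 p) (hq1 p) _ _
    have hV'V : ∀ p, V' p ≤ V p := fun p => avoidProb_anti (hq0 p) (hq1 p) _ fun i => Or.inl
    -- A prime p ∣ a multiplies the main term by V' p / V p, or kills it if p is forbidden at vertex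
    -- 0; 1 - x p is that multiplier. Conditioning on vertex 0 then gives the full local probability
    -- V p (1 - x p / p).
    set x : ℕ → ℝ := fun p => if S p 0 then 1 else 1 - V' p / V p with hx
    set B := ∏ p ∈ P, V p with hB
    have hx0 : ∀ p, 0 ≤ x p := fun p => by
      simp only [hx]
      split_ifs
      · exact zero_le_one
      · have := div_le_one_of_le₀ (hV'V p) (hVnn p)
        linarith
    have hB0 : 0 ≤ B := Finset.prod_nonneg fun p _ => hVnn p
    have hB1 : B ≤ 1 := Finset.prod_le_one (fun p _ => hVnn p) fun p _ =>
      avoidProb_le_one (hq0 p) (hq1 p) _ _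
    have hmain : (n : ℝ) ^ (k + 1) * ∏ p ∈ P, avoidProb (1 / p) (k + 1) G (S p) =
        n ^ k * B * (n * ∏ p ∈ P, (1 - x p / p)) := by
      have : ∏ p ∈ P, avoidProb (1 / p) (k + 1) G (S p) = B * ∏ p ∈ P, (1 - x p / p) := by
        rw [hB, ← Finset.prod_mul_distrib]
        refine Finset.prod_congr rfl fun p hp => ?_
        have h1 : avoidProb (1 / p) (k + 1) G (S p) =
            (1 - 1 / p) * V p + if S p 0 then 0 else 1 / p * V' p := rfl
        have h2 := (hVpos p hp).ne'
        rw [h1]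
        simp only [hx]
        split_ifs
        · ring
        · field_simp; ring
      rw [this]; ring
    -- Off the forbidden primes x p ≤ k / p, since forbidding at most k more vertices loses at most
    -- a proportion k / p.
    have hU := abs_sieveSum_sub_le_log hP hx0 (fun p => S p 0) k
      (fun p _ h => by simp [hx, h])
      (fun p hp h => by
        simp only [hx, h, if_false]
        have := avoidProb_or_ge (hq0 p) (hq1 p) G' (fun i => S p i.succ) fun i => G.Adj 0 i.succ
        have h3 : (1 - k * (1 / p)) ≤ V' p / V p := by
          rw [le_div_iff₀ (hVpos p hp)]; exact this
        rw [mul_one_div] at h3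
        linarith) hn
    set T : ℕ → ℕ → Fin k → Prop := fun a p i => S p i.succ ∨ (p ∣ a ∧ G.Adj 0 i.succ) with hT
    have hterm : ∀ a : ℕ,
        |((if ∀ p ∈ P, p ∣ a → ¬ S p 0 then sieveCount n P k G' (T a) else 0 : ℕ) : ℝ) -
          n ^ k * B * ∏ p ∈ P, (if p ∣ a then 1 - x p else 1)| ≤
        C * (θ * n ^ (k - 1) * (1 + Real.log n) ^ (k - 1)) * 2 ^ #{p ∈ P | p ∣ a} := by
      intro a
      split_ifs with hok
      · have e : B * ∏ p ∈ P, (if p ∣ a then 1 - x p else 1) =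
            ∏ p ∈ P, avoidProb (1 / p) k G' (T a p) := by
          rw [hB, ← Finset.prod_mul_distrib]
          refine Finset.prod_congr rfl fun p hp => ?_
          by_cases hpa : p ∣ a
          · have h1 : avoidProb (1 / p) k G' (T a p) = V' p := by
              simp only [hT, hpa, true_and, hV']
            have h2 := (hVpos p hp).ne'
            rw [if_pos hpa, h1]
            simp only [hx, if_neg (hok p hp hpa)]
            field_simp; ring
          · simp only [hT, hpa, false_and, or_false, if_false, mul_one, hV]
        rw [mul_assoc, e]
        -- Each vertex gains forbidden primes only among the divisors of a, so θ grows by at most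
        -- this power of 2.
        refine (hC n P G' (T a) (θ * 2 ^ #{p ∈ P | p ∣ a}) hn hP ?_).trans (le_of_eq (by ring))
        intro i
        refine le_trans ?_ (mul_le_mul_of_nonneg_right (hθ i.succ) (by positivity))
        rw [← pow_add]
        refine pow_le_pow_right₀ one_le_two ?_
        refine le_trans (card_le_card ?_) (card_union_le _ _)
        intro p
        simp only [hT, mem_filter, mem_union]
        tauto
      · have e : ∏ p ∈ P, (if p ∣ a then 1 - x p else 1) = 0 := by
          push Not at hok
          obtain ⟨p, hp, hpa, hS⟩ := hok
          exact Finset.prod_eq_zero hp (by simp [hpa, hx, hS])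
        rw [e]
        simp only [Nat.cast_zero, mul_zero, sub_zero, abs_zero]
        positivity
    have hsum : |(sieveCount n P (k + 1) G S : ℝ) - n ^ k * B * sieveSum P x n| ≤
        C * (2 * Real.exp 1) * (θ * n ^ k * (1 + Real.log n) ^ k) := by
      have e : (sieveCount n P (k + 1) G S : ℝ) - n ^ k * B * sieveSum P x n =
          ∑ a ∈ Icc 1 n, (((if ∀ p ∈ P, p ∣ a → ¬ S p 0 then sieveCount n P k G' (T a) else 0 : ℕ) : ℝ) -
            n ^ k * B * ∏ p ∈ P, (if p ∣ a then 1 - x p else 1)) := by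
        rw [Finset.sum_sub_distrib, ← Finset.mul_sum, sieveCount, Nat.cast_sum]
        rfl
      rw [e]
      refine (Finset.abs_sum_le_sum_abs _ _).trans ((Finset.sum_le_sum fun a _ => hterm a).trans ?_)
      rw [← Finset.mul_sum]
      refine (mul_le_mul_of_nonneg_left (sieveSum_two_pow_le hP hn) (by positivity)).trans
        (le_of_eq ?_)
      rcases k with _ | k
      · simp [hCk rfl]
      · simp only [Nat.add_sub_cancel]
        ring
    have hsecond : |(n : ℝ) ^ k * B * sieveSum P x n - n ^ k * B * (n * ∏ p ∈ P, (1 - x p / p))| ≤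
        Real.exp 1 * 2 ^ k * (θ * n ^ k * (1 + Real.log n) ^ k) := by
      rw [← mul_sub, abs_mul, abs_of_nonneg (by positivity)]
      have h1 : (n : ℝ) ^ k * B ≤ n ^ k := mul_le_of_le_one_right (by positivity) hB1
      have h2 : Real.exp 1 * 2 ^ k * ((2 : ℝ) ^ #{p ∈ P | S p 0} * (1 + Real.log n) ^ k) ≤
          Real.exp 1 * 2 ^ k * (θ * (1 + Real.log n) ^ k) := by
        have := hθ 0
        gcongr
      refine (mul_le_mul h1 (hU.trans h2) (abs_nonneg _) (by positivity)).trans (le_of_eq (by ring))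
    rw [hmain, Nat.add_sub_cancel]
    calc _ ≤ _ := abs_sub_le _ ((n : ℝ) ^ k * B * sieveSum P x n) _
      _ ≤ _ := add_le_add hsum hsecond
      _ = _ := by ring

/-! ### Identification of the local factors and of f_G, and convergence of A_G. -/

open Classical in
theorem sum_ite_eq_sum_card_mul {k : ℕ} (R : Finset (Fin k) → Prop) (g : ℕ → ℝ) :
    ∑ T : Finset (Fin k), (if R T then g #T else 0) =
      ∑ m ∈ range (k + 1), (#{T : Finset (Fin k) | R T ∧ #T = m} : ℝ) * g m := by
  rw [← Finset.sum_fiberwise_of_maps_to (g := fun T : Finset (Fin k) => #T) (t := range (k + 1))]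
  · refine Finset.sum_congr rfl fun m _ => ?_
    rw [← Finset.sum_filter, Finset.filter_filter, Finset.filter_congr (q := fun T => R T ∧ #T = m)]
    · rw [Finset.sum_congr rfl (g := fun _ => g m)]
      · simp
      · intro T hT; rw [(mem_filter.1 hT).2.2]
    · intro T _; exact and_comm
  · intro T _
    have : #T ≤ k := by simpa using card_le_univ T
    simp; omega

theorem sum_numIndep_mul {k : ℕ} (G : SimpleGraph (Fin k)) (q : ℝ) :
    ∑ m ∈ range (k + 1), (numIndep G m : ℝ) * (q ^ m * (1 - q) ^ (k - m)) =
      avoidProb q k G fun _ => False := by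
  classical
  rw [avoidProb_eq_sum]
  have h := sum_ite_eq_sum_card_mul (fun T : Finset (Fin k) => G.IsIndepSet T)
    fun m => q ^ m * (1 - q) ^ (k - m)
  have e : ∀ m, numIndep G m = #{T : Finset (Fin k) | G.IsIndepSet T ∧ #T = m} := by
    intro m
    rw [numIndep]
    congr 1
    ext T
    simp only [mem_filter, SimpleGraph.isNIndepSet_iff]
  simp only [e]
  refine Eq.trans ?_ (h.symm.trans (Finset.sum_congr rfl fun T _ => by simp))
  refine Finset.sum_congr rfl fun m _ => ?_
  congr!

theorem sum_numIndepMeeting_mul {k : ℕ} (G : SimpleGraph (Fin k)) (S : Finset (Fin k)) (q : ℝ) :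
    ∑ m ∈ range (k + 1), (numIndepMeeting G S m : ℝ) * (q ^ m * (1 - q) ^ (k - m)) =
      avoidProb q k G (fun _ => False) - avoidProb q k G fun i => i ∈ S := by
  classical
  rw [avoidProb_eq_sum, avoidProb_eq_sum, ← Finset.sum_sub_distrib]
  have h := sum_ite_eq_sum_card_mul (fun T : Finset (Fin k) => G.IsIndepSet T ∧ ∃ v ∈ T, v ∈ S)
    fun m => q ^ m * (1 - q) ^ (k - m)
  have e : ∀ m, numIndepMeeting G S m =
      #{T : Finset (Fin k) | (G.IsIndepSet T ∧ ∃ v ∈ T, v ∈ S) ∧ #T = m} := by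
    intro m
    simp only [numIndepMeeting, SimpleGraph.isNIndepSet_iff]
    congr 1
    ext T
    simp only [mem_filter]
    tauto
  simp only [e]
  refine Eq.trans (Finset.sum_congr rfl fun m _ => ?_) (h.symm.trans ?_)
  · congr!
  refine Finset.sum_congr rfl fun T _ => ?_
  by_cases h1 : G.IsIndepSet T
  · by_cases h2 : ∃ v ∈ T, v ∈ S
    · have h3 : ¬ ∀ i ∈ T, i ∉ S := by push Not; exact h2
      simp [h1, h2, h3]
    · have h3 : ∀ i ∈ T, i ∉ S := by push Not at h2; exact h2
      simp only [h1, h2, true_and, if_false, not_false_eq_true, implies_true, if_true]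
      rw [if_pos h3, sub_self]
  · simp [h1]

theorem localFactor_eq_avoidProb {k : ℕ} (G : SimpleGraph (Fin k)) (p : ℕ) :
    localFactor G p = avoidProb (1 / p) k G fun _ => False := by
  rw [← sum_numIndep_mul, localFactor]
  refine Finset.sum_congr rfl fun m _ => ?_
  rw [one_div_pow]; ring

theorem localFactor_ne_zero {k : ℕ} (G : SimpleGraph (Fin k)) {p : ℕ} (hp : p.Prime) :
    localFactor G p ≠ 0 := by
  rw [localFactor_eq_avoidProb]
  refine (avoidProb_pos (by positivity) ?_ _ _).ne'
  have : (1 : ℝ) < p := by exact_mod_cast hp.one_lt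
  rw [div_lt_one (by linarith)]; exact this

/-- Scaling by p ^ k turns (p - 1) ^ (k - m) into the probability of a given m-set, and independent
sets meeting S are those not avoiding it. -/
theorem one_sub_div_eq_avoidProb_div {k : ℕ} (G : SimpleGraph (Fin k)) (S : Finset (Fin k)) {p : ℕ}
    (hp : p.Prime) :
    1 - (∑ m ∈ range (k + 1), (numIndepMeeting G S m : ℝ) * ((p : ℝ) - 1) ^ (k - m)) /
        (∑ m ∈ range (k + 1), (numIndep G m : ℝ) * ((p : ℝ) - 1) ^ (k - m)) =
      avoidProb (1 / p) k G (fun i => i ∈ S) / localFactor G p := by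
  have hp0 : (p : ℝ) ≠ 0 := by exact_mod_cast hp.ne_zero
  have e : ∀ c : ℕ → ℕ, ∑ m ∈ range (k + 1), (c m : ℝ) * ((p : ℝ) - 1) ^ (k - m) =
      p ^ k * ∑ m ∈ range (k + 1), (c m : ℝ) * ((1 / (p : ℝ)) ^ m * (1 - 1 / (p : ℝ)) ^ (k - m)) := by
    intro c
    rw [Finset.mul_sum]
    refine Finset.sum_congr rfl fun m hm => ?_
    have hm' : m ≤ k := by simpa [Nat.lt_succ_iff] using hm
    have h1 : (p : ℝ) ^ k = p ^ m * p ^ (k - m) := by rw [← pow_add]; congr 1; omega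
    have h2 : (p : ℝ) - 1 = p * (1 - 1 / p) := by field_simp
    rw [h1, h2, mul_pow, one_div_pow]
    field_simp
  have hpos := localFactor_ne_zero G hp
  rw [e, e, sum_numIndep_mul, sum_numIndepMeeting_mul, ← localFactor_eq_avoidProb,
    mul_div_mul_left _ _ (pow_ne_zero k hp0), sub_div, div_self hpos, sub_sub_cancel]

theorem multipliable_localFactor {k : ℕ} (G : SimpleGraph (Fin k)) :
    Multipliable fun p : Nat.Primes => localFactor G (p : ℕ) := by
  have hs : Summable fun p : Nat.Primes => ‖localFactor G (p : ℕ) - 1‖ := by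
    have h2 : Summable fun m : ℕ => (k : ℝ) ^ 2 * (1 / (m : ℝ)) ^ 2 := by
      simp only [one_div_pow]
      exact (Real.summable_one_div_nat_pow.2 one_lt_two).mul_left _
    refine Summable.of_nonneg_of_le (fun _ => norm_nonneg _) (fun p => ?_)
      (h2.comp_injective (Subtype.val_injective : Function.Injective fun p : Nat.Primes => (p : ℕ)))
    have hq0 : 0 ≤ 1 / ((p : ℕ) : ℝ) := by positivity
    have hq1 : 1 / ((p : ℕ) : ℝ) ≤ 1 := by simpa using Nat.cast_inv_le_one (α := ℝ) (p : ℕ)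
    rw [localFactor_eq_avoidProb, Real.norm_eq_abs, abs_sub_comm,
      abs_of_nonneg (sub_nonneg.2 (avoidProb_le_one hq0 hq1 _ _))]
    exact one_sub_avoidProb_le hq0 hq1 G
  have := multipliable_one_add_of_summable hs
  simpa using this

theorem numSqfreeDivisors_eq_two_pow {v : ℕ} (hv : v ≠ 0) :
    numSqfreeDivisors v = 2 ^ #v.primeFactors := by
  classical
  rw [numSqfreeDivisors, ← Finset.card_powerset]
  have h := congrArg Multiset.card (Nat.divisors_filter_squarefree hv)
  rw [Multiset.card_map] at h
  rw [Finset.card_def, Finset.card_def]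
  have e : v.primeFactors = (UniqueFactorizationMonoid.normalizedFactors v).toFinset := by
    ext p
    rw [Multiset.mem_toFinset, Nat.factors_eq, Multiset.mem_coe,
      Nat.mem_primeFactors_iff_mem_primeFactorsList]
  rw [e]
  convert h using 2

/-! ### From coprimality to a finite set of primes, and the limit. -/

theorem coprime_iff_forall_mem_not_dvd {P : Finset ℕ} (hP : ∀ p ∈ P, p.Prime) {a b : ℕ}
    (h : ∀ p, p.Prime → p ∣ a → p ∈ P) : Nat.Coprime a b ↔ ∀ p ∈ P, ¬ (p ∣ a ∧ p ∣ b) := by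
  constructor
  · rintro hab p hp ⟨h1, h2⟩
    exact Nat.not_coprime_of_dvd_of_dvd (hP p hp).one_lt h1 h2 hab
  · intro hab
    by_contra hn
    obtain ⟨p, hp, h1, h2⟩ := Nat.Prime.not_coprime_iff_dvd.1 hn
    exact hab p (h p hp h1) ⟨h1, h2⟩

theorem Q_eq_sieveCount {P : Finset ℕ} (hP : ∀ p ∈ P, p.Prime) {k : ℕ} (G : SimpleGraph (Fin k))
    (u : Fin k → ℕ) {n : ℕ} (h : ∀ p, p.Prime → p ≤ n → p ∈ P) :
    Q G u n = sieveCount n P k G fun p i => i ∈ divIndices u p := by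
  classical
  rw [sieveCount_eq_card, Q]
  congr 1
  ext a
  simp only [mem_filter]
  refine and_congr_right fun ha => ?_
  have hd : ∀ i p, p.Prime → p ∣ a i → p ∈ P := fun i p hp hpa => by
    have := mem_Icc.1 (Fintype.mem_piFinset.1 ha i)
    exact h p hp ((Nat.le_of_dvd this.1 hpa).trans this.2)
  simp only [coprime_iff_forall_mem_not_dvd hP (hd _), divIndices, mem_filter, mem_univ, true_and,
    not_and]

theorem prod_avoidProb_eq {P : Finset ℕ} (hP : ∀ p ∈ P, p.Prime) {k : ℕ} (G : SimpleGraph (Fin k))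
    {u : Fin k → ℕ} (hu : ∀ i, 1 ≤ u i) (h : (∏ i, u i).primeFactors ⊆ P) :
    ∏ p ∈ P, avoidProb (1 / p) k G (fun i => i ∈ divIndices u p) =
      (∏ p ∈ P, localFactor G p) * f G u := by
  have hf : f G u =
      ∏ p ∈ P, avoidProb (1 / p) k G (fun i => i ∈ divIndices u p) / localFactor G p := by
    rw [f, Finset.prod_congr rfl fun p hp =>
      one_sub_div_eq_avoidProb_div G (divIndices u p) (Nat.prime_of_mem_primeFactors hp)]
    refine Finset.prod_subset h fun p hp hpu => ?_
    have e : (fun i => i ∈ divIndices u p) = fun _ => False := by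
      funext i
      simp only [divIndices, mem_filter, mem_univ, true_and, eq_iff_iff, iff_false]
      intro hd
      refine hpu (Nat.mem_primeFactors.2 ⟨hP p hp, hd.trans (dvd_prod_of_mem u (mem_univ i)), ?_⟩)
      exact Finset.prod_ne_zero_iff.2 fun i _ => (Nat.one_le_iff_ne_zero.1 (hu i))
    rw [e, ← localFactor_eq_avoidProb, div_self (localFactor_ne_zero G (hP p hp))]
  rw [hf, ← Finset.prod_mul_distrib]
  refine Finset.prod_congr rfl fun p hp => ?_
  rw [mul_div_cancel₀ _ (localFactor_ne_zero G (hP p hp))]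

end GWise

open Finset Filter Topology in
theorem theorem1 (k : ℕ) (hk : 1 ≤ k) (G : SimpleGraph (Fin k)) :
    Multipliable (fun p : Nat.Primes => GWise.localFactor G (p : ℕ)) ∧
    ∃ C : ℝ, ∀ (n : ℕ) (u : Fin k → ℕ), 2 ≤ n → (∀ i, 1 ≤ u i) →
      |(GWise.Q G u n : ℝ) - GWise.A G * GWise.f G u * (n : ℝ) ^ k| ≤
        C * ((GWise.theta u : ℝ) * (n : ℝ) ^ (k - 1) * Real.log (n : ℝ) ^ (k - 1)) := by
  classical
  refine ⟨GWise.multipliable_localFactor G, ?_⟩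
  obtain ⟨C, hC0, -, hC⟩ := GWise.exists_abs_sieveCount_sub_le k
  -- The extra factor replaces 1 + log n by log n, as 1 ≤ log n / log 2 for n ≥ 2.
  refine ⟨C * (1 / Real.log 2 + 1) ^ (k - 1), fun n u hn hu => ?_⟩
  have hl2 : 0 < Real.log 2 := Real.log_pos one_lt_two
  have hlog : 1 + Real.log n ≤ (1 / Real.log 2 + 1) * Real.log n := by
    have h1 : Real.log 2 ≤ Real.log n := Real.log_le_log two_pos (by exact_mod_cast hn)
    have h2 : 1 ≤ Real.log n / Real.log 2 := (one_le_div hl2).2 h1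
    calc 1 + Real.log n ≤ Real.log n / Real.log 2 + Real.log n := by linarith
      _ = _ := by ring
  have hl0 : 0 ≤ Real.log n := Real.log_natCast_nonneg n
  have hlim : Tendsto (fun s : Finset Nat.Primes => |(GWise.Q G u n : ℝ) -
      (∏ p ∈ s, GWise.localFactor G (p : ℕ)) * GWise.f G u * (n : ℝ) ^ k|) atTop
      (𝓝 |(GWise.Q G u n : ℝ) - GWise.A G * GWise.f G u * (n : ℝ) ^ k|) :=
    (tendsto_const_nhds.sub (((GWise.multipliable_localFactor G).hasProd.mul_const _).mul_const _)).abs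
  refine le_of_tendsto hlim ?_
  -- The primes up to n make the sieve count equal to Q; those dividing the u_i make f_G(u)
  -- complete. The bound then holds for every finite set of primes containing F, hence in the limit.
  let F : Finset ℕ := {p ∈ range (n + 1) | p.Prime} ∪ (∏ i, u i).primeFactors
  have hF : ∀ p ∈ F, p.Prime := by
    intro p hp
    rcases mem_union.1 hp with h | h
    · exact (mem_filter.1 h).2
    · exact Nat.prime_of_mem_primeFactors h
  filter_upwards [eventually_ge_atTop (F.subtype Nat.Prime)] with s hs
  let P : Finset ℕ := s.image fun p : Nat.Primes => (p : ℕ)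
  have hprod : ∏ p ∈ P, GWise.localFactor G p = ∏ p ∈ s, GWise.localFactor G (p : ℕ) :=
    prod_image fun p _ q _ hpq => Nat.Primes.coe_nat_injective hpq
  have hP : ∀ p ∈ P, p.Prime := by
    intro p hp
    obtain ⟨q, -, rfl⟩ := mem_image.1 hp
    exact q.2
  have hFP : F ⊆ P := fun p hp =>
    mem_image.2 ⟨⟨p, hF p hp⟩, hs (mem_subtype.2 hp), rfl⟩
  have hθ : ∀ i, (2 : ℝ) ^ #{p ∈ P | i ∈ GWise.divIndices u p} ≤ GWise.theta u := by
    intro i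
    have h1 : #{p ∈ P | i ∈ GWise.divIndices u p} ≤ #(u i).primeFactors := by
      refine card_le_card fun p hp => ?_
      simp only [GWise.divIndices, mem_filter, mem_univ, true_and] at hp
      exact Nat.mem_primeFactors.2 ⟨hP p hp.1, hp.2, (Nat.one_le_iff_ne_zero.1 (hu i))⟩
    have h2 : 2 ^ #(u i).primeFactors ≤ GWise.theta u := by
      rw [← GWise.numSqfreeDivisors_eq_two_pow (Nat.one_le_iff_ne_zero.1 (hu i)), GWise.theta]
      exact Finset.le_sup (f := fun i => GWise.numSqfreeDivisors (u i)) (mem_univ i)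
    exact_mod_cast (Nat.pow_le_pow_right two_pos h1).trans h2
  have h := hC n P G (fun p i => i ∈ GWise.divIndices u p) (GWise.theta u) (by omega) hP
    fun i => by convert hθ i
  rw [← GWise.Q_eq_sieveCount hP G u fun p hp hpn => hFP (mem_union_left _
      (mem_filter.2 ⟨mem_range.2 (by omega), hp⟩)),
    GWise.prod_avoidProb_eq hP G hu (subset_union_right.trans hFP), hprod, mul_comm] at h
  refine h.trans ?_
  calc C * (GWise.theta u * (n : ℝ) ^ (k - 1) * (1 + Real.log n) ^ (k - 1))
      ≤ C * (GWise.theta u * (n : ℝ) ^ (k - 1) * ((1 / Real.log 2 + 1) * Real.log n) ^ (k - 1)) := by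
        gcongr
    _ = _ := by rw [mul_pow]; ring
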